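/- A bipartite max-min LP consists of a finite bipartite graph $\mathcal G=(V\cup I\cup K,E)$, with $V,I,K$ disjoint, in which every edge joins an agent $v\in V$ to a constraint $i\in I$ or to an objective $k\in K$ and every agent is adjacent to exactly one constraint and exactly one objective, together with coefficients $a_{iv}\ge 0$ on the edges $\{i,v\}$ and $c_{kv}\ge 0$ on the edges $\{k,v\}$. Write $V_i$ and $V_k$ for the sets of agents adjacent to $i\in I$ and to $k\in K$. A vector $x\in\mathbb R^V$ is feasible if $x_v\ge 0$ for all $v\in V$ and $\sum_{v\in V_i}a_{iv}x_v\le 1$ for all $i\in I$, and the optimum is $$\omega^*=\sup_{x\text{ feasible}}\ \min_{k\in K}\ \sum_{v\in V_k}c_{kv}x_v .$$ A local algorithm that uses only port numbering is a deterministic synchronous message-passing algorithm, the same for all nodes of $\mathcal G$, that runs for a number of rounds $r$ independent of the input. The nodes have no identifiers; each node has an arbitrary ordering of its incident edges (its ports) and initially knows only whether it is an agent, a constraint or an objective, its degree and, if it is an agent, for each of its ports whether the port leads to the constraint or to the objective and the coefficient of that edge. In each round every node sends a message through each of its ports, receives one message from each port and updates its state; after $r$ rounds each agent $v$ outputs a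 number $x_v$. Theorem. For all integers $\Delta_I\ge 2$ and $\Delta_K\ge 2$ and every real $\epsilon>0$ there is a local algorithm that uses only port numbering and such that the following holds for every bipartite max-min LP with $|V_i|\le\Delta_I$ for all $i\in I$ and $|V_k|\le\Delta_K$ for all $k\in K$, and for every port numbering of its graph. The output $x$ is feasible. Moreover, if each agent $v$ with constraint $i$ and objective $k$ satisfies $a_{iv}>0$ whenever $c_{kv}>0$ (equivalently, if each single objective function is bounded above on the set of feasible solutions), then the algorithm has approximation ratio $\Delta_I(1-1/\Delta_K)+\epsilon$, that is, $$\sum_{v\in V_k}c_{kv}x_v\ \ge\ \frac{\omega^*}{\Delta_I(1-1/\Delta_K)+\epsilon}\qquad\text{for all }k\in K.$$ -/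

import Mathlib

/-- The vertices of a communication graph: agents, constraints and objectives. -/
inductive Node (V I K : Type*) where
  | agent (v : V)
  | constr (i : I)
  | obj (k : K)

/-- The data of a max-min linear program: a graph on `V ∪ I ∪ K` each of whose edges joins an
agent to a constraint or to an objective, with a nonnegative coefficient on every edge.
The values of `a` and `c` at non-adjacent pairs are never used. -/
structure MaxMinLP (V I K : Type*) where
  graph : SimpleGraph (Node V I K)
  not_adj_agent_agent : ∀ u v : V, ¬ graph.Adj (.agent u) (.agent v)
  not_adj_constr_constr : ∀ i j : I, ¬ graph.Adj (.constr i) (.constr j)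
  not_adj_constr_obj : ∀ (i : I) (k : K), ¬ graph.Adj (.constr i) (.obj k)
  not_adj_obj_obj : ∀ k l : K, ¬ graph.Adj (.obj k) (.obj l)
  a : I → V → ℝ
  c : K → V → ℝ
  a_nonneg : ∀ i v, graph.Adj (.agent v) (.constr i) → 0 ≤ a i v
  c_nonneg : ∀ k v, graph.Adj (.agent v) (.obj k) → 0 ≤ c k v

namespace MaxMinLP

variable {V I K : Type*}

open Classical in
/-- The set `V_i` of agents adjacent to the constraint `i`. -/
noncomputable def constrAgents [Fintype V] (P : MaxMinLP V I K) (i : I) : Finset V :=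
  Finset.univ.filter fun v => P.graph.Adj (.agent v) (.constr i)

open Classical in
/-- The set `V_k` of agents adjacent to the objective `k`. -/
noncomputable def objAgents [Fintype V] (P : MaxMinLP V I K) (k : K) : Finset V :=
  Finset.univ.filter fun v => P.graph.Adj (.agent v) (.obj k)

/-- The bipartite version: every agent is adjacent to exactly one constraint and to exactly one
objective. -/
def IsBipartite (P : MaxMinLP V I K) : Prop :=
  ∀ v : V, (∃! i : I, P.graph.Adj (.agent v) (.constr i)) ∧
    (∃! k : K, P.graph.Adj (.agent v) (.obj k))

/-- The degree bounds `|V_i| ≤ ΔI` and `|V_k| ≤ ΔK`. -/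
def DegreeBounded [Fintype V] (P : MaxMinLP V I K) (ΔI ΔK : ℕ) : Prop :=
  (∀ i, (P.constrAgents i).card ≤ ΔI) ∧ (∀ k, (P.objAgents k).card ≤ ΔK)

/-- The value of the objective `k` at `x`. -/
noncomputable def objective [Fintype V] (P : MaxMinLP V I K) (k : K) (x : V → ℝ) : ℝ :=
  ∑ v ∈ P.objAgents k, P.c k v * x v

def IsFeasible [Fintype V] (P : MaxMinLP V I K) (x : V → ℝ) : Prop :=
  (∀ i, ∑ v ∈ P.constrAgents i, P.a i v * x v ≤ 1) ∧ ∀ v, 0 ≤ x v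

/-- The utility of `x`: the minimum of the objectives (`K` is finite wherever this is used). -/
noncomputable def utility [Fintype V] (P : MaxMinLP V I K) (x : V → ℝ) : ℝ :=
  ⨅ k, P.objective k x

/-- The optimum of the max-min LP. -/
noncomputable def opt [Fintype V] (P : MaxMinLP V I K) : ℝ :=
  sSup (P.utility '' {x | P.IsFeasible x})

/-- An agent that contributes to its objective with a positive coefficient also has a positive
coefficient in its constraint. For a bipartite max-min LP this says exactly that each objective
function is bounded above on the feasible set. -/
def NonDegenerate (P : MaxMinLP V I K) : Prop :=
  ∀ v i k, P.graph.Adj (.agent v) (.constr i) → P.graph.Adj (.agent v) (.obj k) →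
    0 < P.c k v → 0 < P.a i v

/-- A port numbering: every vertex independently orders the edges incident to it, that is, it
lists its neighbours without repetition. The port number of the edge `{s, t}` in `s` is the
position of `t` in `ports s`. -/
structure PortNumbering (P : MaxMinLP V I K) where
  ports : Node V I K → List (Node V I K)
  nodup : ∀ s, (ports s).Nodup
  mem_ports : ∀ s t, t ∈ ports s ↔ P.graph.Adj s t

end MaxMinLP

/-- What a node knows at the start, in the absence of identifiers. An agent knows, for each of its
ports in turn, whether the port leads to a constraint (`Sum.inl`) or to an objective (`Sum.inr`),
and the coefficient on that edge. A constraint or an objective knows only its number of ports. -/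
inductive LocalInput where
  | agent (edges : List (ℝ ⊕ ℝ))
  | constr (degree : ℕ)
  | obj (degree : ℕ)

/-- A deterministic synchronous distributed algorithm in the port-numbering model that stops
after a fixed number of communication rounds (its local horizon). In each round, every node sends
through each of its ports a message that depends on its state and on the port number; it then
updates its state, using the list of the messages received through its ports, in the order of the
ports. -/
structure PortAlgorithm where
  State : Type
  Msg : Type
  horizon : ℕ
  init : LocalInput → State
  send : State → ℕ → Msg
  step : State → List Msg → State
  output : State → ℝ

namespace PortAlgorithm

variable {V I K : Type*} {P : MaxMinLP V I K}

/-- The local input of a node. (The ports of an agent never lead to another agent, so that the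
list below has one entry for each port.) -/
def localInput (N : P.PortNumbering) : Node V I K → LocalInput
  | .agent v => .agent <| (N.ports (.agent v)).filterMap fun t =>
      match t with
      | .agent _ => none
      | .constr i => some (.inl (P.a i v))
      | .obj k => some (.inr (P.c k v))
  | .constr i => .constr (N.ports (.constr i)).length
  | .obj k => .obj (N.ports (.obj k)).length

open Classical in
/-- The state of each node after the given number of rounds. The node `s` receives through the port
that leads to `t` the message that `t` sends through its port that leads to `s`. -/
noncomputable def state (A : PortAlgorithm) (N : P.PortNumbering) : ℕ → Node V I K → A.State
  | 0, s => A.init (localInput N s)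
  | n + 1, s => A.step (state A N n s)
      ((N.ports s).map fun t => A.send (state A N n t) ((N.ports t).idxOf s))

/-- The solution computed by the algorithm: each agent outputs the value of its variable when the
last round is over. -/
noncomputable def run (A : PortAlgorithm) (N : P.PortNumbering) (v : V) : ℝ :=
  A.output (A.state N A.horizon (.agent v))

end PortAlgorithm

/-! A vector that lifts every objective to a target `ω` satisfies bounds that can be computed by
alternation: lower bounds on the variables force upper bounds through the constraints, and these
force better lower bounds through the objectives. The bounds of depth `R` at an agent depend only
on its neighbourhood, and the largest `ω` for which they are consistent there is at least the
optimum. Replacing this `ω` at each agent by its minimum over a ball gives targets that differ from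
agent to agent, are still at least the optimum, and for which all bounds of depth at most `R` are
consistent.

A constraint with `Δ` agents admits the lower bounds plus `1 / Δ` times the gap to the upper bounds.
The upper bounds of depth `d` and the lower bounds of depth `d + 1` together meet the targets, so
the average of these solutions over the depths `d < R` reaches, by telescoping, the approximation
ratio up to a factor `1 - 1 / R`.

To see that the solution is local, it suffices that each quantity involved is, for all instances
alike, a function of the unfolding of the graph around the agent to some fixed depth, since a
message-passing algorithm can collect this unfolding.
-/

section Peers

open Classical in
/-- The agents with the same label as `v`; the labels used are the constraint and the objective
of an agent. -/
noncomputable def peers {V ι : Type*} [Fintype V] (label : V → ι) (v : V) : Finset V :=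
  Finset.univ.filter fun u => label u = label v

variable {V ι : Type*} [Fintype V] {label : V → ι}

lemma mem_peers {u v : V} : u ∈ peers label v ↔ label u = label v := by
  simp [peers]

lemma self_mem_peers (label : V → ι) (v : V) : v ∈ peers label v :=
  mem_peers.2 rfl

lemma peers_congr {u v : V} (h : label u = label v) : peers label u = peers label v := by
  ext
  simp [mem_peers, h]

end Peers

lemma sum_sub_self_le_sum_sub_self {V M : Type*} [AddCommGroup M] [PartialOrder M]
    [IsOrderedAddMonoid M] {s : Finset V} {v : V} (hv : v ∈ s) {f g : V → M}
    (h : ∀ u ∈ s, f u ≤ g u) : ∑ u ∈ s, f u - f v ≤ ∑ u ∈ s, g u - g v := by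
  classical
  rw [← Finset.sum_erase_eq_sub hv, ← Finset.sum_erase_eq_sub hv]
  exact Finset.sum_le_sum fun u hu => h u (Finset.mem_of_mem_erase hu)

/-- The combinatorial core of a bipartite max-min linear program, after rescaling the variables so
that the objectives have unit coefficients: `w v` is the coefficient of the agent `v` in its
constraint `con v`. -/
structure AgentSystem (V I K : Type*) where
  con : V → I
  obj : V → K
  w : V → ℝ
  w_pos : ∀ v, 0 < w v

namespace AgentSystem

section Reach

variable {V I K : Type*} (S : AgentSystem V I K)

/-- The agents that share their constraint or their objective with `v`. -/
def nbrs (v : V) : Set V :=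
  {u | S.con u = S.con v ∨ S.obj u = S.obj v}

/-- The agents that can be reached from `v` in `n` steps, each of them to an agent that shares the
constraint or the objective. Every agent is its own neighbour, so that this is a ball. -/
def reach : ℕ → V → Set V
  | 0, v => {v}
  | n + 1, v => ⋃ x ∈ S.nbrs v, reach n x

variable {S} {n : ℕ} {u v x : V}

lemma mem_nbrs_comm : u ∈ S.nbrs v ↔ v ∈ S.nbrs u := by
  simp only [nbrs, Set.mem_ofPred_eq, eq_comm]

lemma self_mem_nbrs (v : V) : v ∈ S.nbrs v :=
  Or.inl rfl

lemma mem_reach_succ : u ∈ S.reach (n + 1) v ↔ ∃ x ∈ S.nbrs v, u ∈ S.reach n x := by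
  simp only [reach, Set.mem_iUnion, exists_prop]

lemma self_mem_reach (n : ℕ) (v : V) : v ∈ S.reach n v := by
  induction n with
  | zero => rfl
  | succ n ih => exact mem_reach_succ.2 ⟨v, self_mem_nbrs v, ih⟩

lemma mem_reach_succ_of_mem_nbrs (hu : u ∈ S.reach n v) (hx : x ∈ S.nbrs u) :
    x ∈ S.reach (n + 1) v := by
  induction n generalizing v with
  | zero =>
    obtain rfl := Set.mem_singleton_iff.1 hu
    exact mem_reach_succ.2 ⟨x, hx, rfl⟩
  | succ n ih =>
    obtain ⟨z, hz, hu⟩ := mem_reach_succ.1 hu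
    exact mem_reach_succ.2 ⟨z, hz, ih hu⟩

lemma mem_reach_comm : u ∈ S.reach n v ↔ v ∈ S.reach n u := by
  suffices symm : ∀ {u v : V}, u ∈ S.reach n v → v ∈ S.reach n u from ⟨symm, symm⟩
  induction n with
  | zero => exact fun h => (Set.mem_singleton_iff.1 h).symm
  | succ n ih =>
    intro u v h
    obtain ⟨z, hz, hu⟩ := mem_reach_succ.1 h
    exact mem_reach_succ_of_mem_nbrs (ih hu) (mem_nbrs_comm.1 hz)

end Reach

variable {V I K : Type*} [Fintype V] (S : AgentSystem V I K)

/-- `y` is a feasible vector that lifts the objective of each agent `v` to the target `σ v`. -/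
structure Meets (σ y : V → ℝ) : Prop where
  nonneg : ∀ v, 0 ≤ y v
  con_le : ∀ v, ∑ u ∈ peers S.con v, S.w u * y u ≤ 1
  le_obj : ∀ v, σ v ≤ ∑ u ∈ peers S.obj v, y u

/-- The largest value that `v` can take if the other agents of its constraint take the values
given by `L`. -/
noncomputable def upperOf (L : V → ℝ) (v : V) : ℝ :=
  (1 - (∑ u ∈ peers S.con v, S.w u * L u - S.w v * L v)) / S.w v

/-- The least nonnegative value with which `v` lifts its objective to `σ v` if the other agents of
the objective take the values given by `U`. -/
noncomputable def lowerOf (σ U : V → ℝ) (v : V) : ℝ :=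
  max 0 (σ v - (∑ u ∈ peers S.obj v, U u - U v))

/-- The lower bounds on the variables that the targets `σ` force after `d` alternations between
objectives and constraints, starting from the bound `0`. -/
noncomputable def lower (σ : V → ℝ) : ℕ → V → ℝ
  | 0 => 0
  | d + 1 => S.lowerOf σ (S.upperOf (lower σ d))

/-- The upper bounds on the variables that the constraints and the lower bounds of depth `d`
force. -/
noncomputable def upper (σ : V → ℝ) (d : ℕ) : V → ℝ :=
  S.upperOf (S.lower σ d)

variable {S}

lemma w_mul_upperOf (L : V → ℝ) (v : V) :
    S.w v * S.upperOf L v = 1 - ∑ u ∈ peers S.con v, S.w u * L u + S.w v * L v := by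
  rw [upperOf, mul_div_cancel₀ _ (S.w_pos v).ne', sub_sub_eq_add_sub, add_sub_right_comm]

lemma upperOf_anti {L L' : V → ℝ} {v : V} (h : ∀ u ∈ peers S.con v, L u ≤ L' u) :
    S.upperOf L' v ≤ S.upperOf L v := by
  have hsum := sum_sub_self_le_sum_sub_self (self_mem_peers S.con v) fun u hu =>
    mul_le_mul_of_nonneg_left (h u hu) (S.w_pos u).le
  exact div_le_div_of_nonneg_right (sub_le_sub_left hsum 1) (S.w_pos v).le

lemma lowerOf_mono {σ σ' U U' : V → ℝ} {v : V} (hσ : σ v ≤ σ' v)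
    (h : ∀ u ∈ peers S.obj v, U' u ≤ U u) : S.lowerOf σ U v ≤ S.lowerOf σ' U' v :=
  max_le_max le_rfl (sub_le_sub hσ (sum_sub_self_le_sum_sub_self (self_mem_peers S.obj v) h))

lemma lower_nonneg (σ : V → ℝ) (d : ℕ) (v : V) : 0 ≤ S.lower σ d v := by
  cases d with
  | zero => exact le_rfl
  | succ d => exact le_max_left _ _

lemma lower_le_lower_succ (σ : V → ℝ) (d : ℕ) (v : V) :
    S.lower σ d v ≤ S.lower σ (d + 1) v := by
  induction d generalizing v with
  | zero => exact lower_nonneg σ 1 v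
  | succ d ih => exact lowerOf_mono le_rfl fun u _ => upperOf_anti fun x _ => ih x

lemma monotone_lower (σ : V → ℝ) (v : V) : Monotone fun d => S.lower σ d v :=
  monotone_nat_of_le_succ fun d => lower_le_lower_succ σ d v

lemma antitone_upper (σ : V → ℝ) (v : V) : Antitone fun d => S.upper σ d v :=
  fun _ _ h => upperOf_anti fun u _ => monotone_lower σ u h

lemma lower_le_upper_of_le {σ : V → ℝ} {v : V} {d R : ℕ} (hd : d ≤ R)
    (h : S.lower σ R v ≤ S.upper σ R v) : S.lower σ d v ≤ S.upper σ d v :=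
  ((monotone_lower σ v hd).trans h).trans (antitone_upper σ v hd)

namespace Meets

variable {σ y : V → ℝ}

lemma le_upperOf (hy : S.Meets σ y) {L : V → ℝ} (hL : ∀ v, L v ≤ y v) (v : V) :
    y v ≤ S.upperOf L v := by
  refine le_trans ?_ (upperOf_anti fun u _ => hL u)
  rw [← mul_le_mul_iff_right₀ (S.w_pos v), w_mul_upperOf]
  linarith [hy.con_le v]

lemma lowerOf_le (hy : S.Meets σ y) {U : V → ℝ} (hU : ∀ v, y v ≤ U v) (v : V) :
    S.lowerOf σ U v ≤ y v := by
  refine (lowerOf_mono le_rfl fun u _ => hU u).trans (max_le (hy.nonneg v) ?_)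
  linarith [hy.le_obj v]

lemma lower_le (hy : S.Meets σ y) (d : ℕ) (v : V) : S.lower σ d v ≤ y v := by
  induction d generalizing v with
  | zero => exact hy.nonneg v
  | succ d ih => exact hy.lowerOf_le (hy.le_upperOf ih) v

lemma lower_le_upper (hy : S.Meets σ y) (d : ℕ) (v : V) : S.lower σ d v ≤ S.upper σ d v :=
  (hy.lower_le d v).trans (hy.le_upperOf (hy.lower_le d) v)

end Meets

lemma meets_zero : S.Meets 0 0 where
  nonneg _ := le_rfl
  con_le _ := by simp
  le_obj _ := by simp

lemma continuous_lower (d : ℕ) (v : V) : Continuous fun ω : ℝ => S.lower (fun _ => ω) d v := by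
  induction d generalizing v with
  | zero => exact continuous_const
  | succ d ih =>
    simp only [lower, lowerOf, upperOf]
    fun_prop

lemma continuous_upper (d : ℕ) (v : V) : Continuous fun ω : ℝ => S.upper (fun _ => ω) d v := by
  have := continuous_lower (S := S) d
  simp only [upper, upperOf]
  fun_prop

variable (S) in
/-- The uniform targets that the bounds of depth `R` at the agent `v` do not rule out. -/
def targets (R : ℕ) (v : V) : Set ℝ :=
  {ω | 0 ≤ ω ∧ S.lower (fun _ => ω) R v ≤ S.upper (fun _ => ω) R v}

variable (S) in
/-- The largest uniform target that the bounds of depth `R` at the agent `v` do not rule out: an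
upper bound on the optimum that `v` can compute. -/
noncomputable def maxTarget (R : ℕ) (v : V) : ℝ :=
  sSup (S.targets R v)

lemma bddAbove_targets {R : ℕ} (hR : R ≠ 0) (v : V) : BddAbove (S.targets R v) := by
  refine ⟨∑ u ∈ peers S.obj v, S.upperOf 0 u, fun ω hω => ?_⟩
  have hbounds : S.lower (fun _ => ω) 1 v ≤ S.upper (fun _ => ω) 0 v :=
    ((monotone_lower _ v (Nat.one_le_iff_ne_zero.2 hR)).trans hω.2).trans
      (antitone_upper _ v (Nat.zero_le R))
  have hlower : ω - (∑ u ∈ peers S.obj v, S.upperOf 0 u - S.upperOf 0 v) ≤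
      S.lower (fun _ => ω) 1 v := le_max_right _ _
  have hupper : S.upper (fun _ => ω) 0 v = S.upperOf 0 v := rfl
  linarith

lemma maxTarget_mem_targets {R : ℕ} (hR : R ≠ 0) (v : V) : S.maxTarget R v ∈ S.targets R v := by
  have hclosed : IsClosed (S.targets R v) :=
    isClosed_Ici.inter (isClosed_le (continuous_lower R v) (continuous_upper R v))
  exact hclosed.csSup_mem ⟨0, le_rfl, meets_zero.lower_le_upper R v⟩ (bddAbove_targets hR v)

lemma Meets.le_maxTarget {R : ℕ} (hR : R ≠ 0) {ω : ℝ} (hω : 0 ≤ ω) {y : V → ℝ}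
    (hy : S.Meets (fun _ => ω) y) (v : V) : ω ≤ S.maxTarget R v :=
  le_csSup (bddAbove_targets hR v) ⟨hω, hy.lower_le_upper R v⟩

lemma lower_le_lower_of_le_on_reach {σ σ' : V → ℝ} (d : ℕ) {v : V}
    (h : ∀ u ∈ S.reach (2 * d) v, σ u ≤ σ' u) : S.lower σ d v ≤ S.lower σ' d v := by
  induction d generalizing v with
  | zero => exact le_rfl
  | succ d ih =>
    refine lowerOf_mono (h v (self_mem_reach _ v)) fun u hu => upperOf_anti fun x hx => ih ?_
    exact fun z hz => h z (mem_reach_succ.2 ⟨u, Or.inr (mem_peers.1 hu),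
      mem_reach_succ.2 ⟨x, Or.inl (mem_peers.1 hx), hz⟩⟩)

lemma upper_le_upper_of_le_on_reach {σ σ' : V → ℝ} (d : ℕ) {v : V}
    (h : ∀ u ∈ S.reach (2 * d + 1) v, σ u ≤ σ' u) : S.upper σ' d v ≤ S.upper σ d v :=
  upperOf_anti fun x hx => lower_le_lower_of_le_on_reach d fun z hz =>
    h z (mem_reach_succ.2 ⟨x, Or.inl (mem_peers.1 hx), hz⟩)

variable (S) in
/-- The minimum of `maxTarget R` over the ball on which the bounds of depth `R` at the agent `v`
depend. -/
noncomputable def localTarget (R : ℕ) (v : V) : ℝ :=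
  sInf (S.maxTarget R '' S.reach (2 * R + 1) v)

lemma le_localTarget {R : ℕ} {ω : ℝ} (h : ∀ v, ω ≤ S.maxTarget R v) (v : V) :
    ω ≤ S.localTarget R v :=
  le_csInf ⟨_, v, self_mem_reach _ v, rfl⟩ (Set.forall_mem_image.2 fun u _ => h u)

lemma localTarget_le_maxTarget {R : ℕ} {u v : V} (h : u ∈ S.reach (2 * R + 1) v) :
    S.localTarget R u ≤ S.maxTarget R v :=
  csInf_le (Set.toFinite _).bddBelow ⟨v, mem_reach_comm.1 h, rfl⟩

/-- On the ball that matters to `v` the targets are at most `maxTarget R v`, for which the bounds at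
`v` are consistent. -/
lemma lower_localTarget_le_upper {R : ℕ} (hR : R ≠ 0) (v : V) :
    S.lower (S.localTarget R) R v ≤ S.upper (S.localTarget R) R v :=
  calc S.lower (S.localTarget R) R v
      ≤ S.lower (fun _ => S.maxTarget R v) R v :=
        lower_le_lower_of_le_on_reach R fun u hu => localTarget_le_maxTarget
          (mem_reach_succ_of_mem_nbrs hu (self_mem_nbrs u))
    _ ≤ S.upper (fun _ => S.maxTarget R v) R v := (maxTarget_mem_targets hR v).2
    _ ≤ S.upper (S.localTarget R) R v :=
        upper_le_upper_of_le_on_reach R fun _ hu => localTarget_le_maxTarget hu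

variable (S) in
/-- The convex combination of the bounds of depth `d` with weight `1 / Δ` on the upper bound. If a
constraint has at most `Δ` agents, this raises each of its terms from the lower bound by at most
an equal share of the slack. -/
noncomputable def layer (Δ : ℕ) (σ : V → ℝ) (d : ℕ) (v : V) : ℝ :=
  (S.upper σ d v + (Δ - 1) * S.lower σ d v) / Δ

variable (S) in
/-- The average of the layers of depth less than `R`. -/
noncomputable def averagedLayer (Δ R : ℕ) (σ : V → ℝ) (v : V) : ℝ :=
  (∑ d ∈ Finset.range R, S.layer Δ σ d v) / R

lemma averagedLayer_nonneg {Δ R : ℕ} (hΔ : Δ ≠ 0) {σ : V → ℝ} {v : V}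
    (h : S.lower σ R v ≤ S.upper σ R v) : 0 ≤ S.averagedLayer Δ R σ v := by
  refine div_nonneg (Finset.sum_nonneg fun d hd => ?_) R.cast_nonneg
  have hlower := lower_nonneg (S := S) σ d v
  have hupper := hlower.trans (lower_le_upper_of_le (Finset.mem_range.1 hd).le h)
  have hΔ' : (0 : ℝ) ≤ Δ - 1 := sub_nonneg.2 (Nat.one_le_cast.2 (Nat.one_le_iff_ne_zero.2 hΔ))
  unfold layer
  positivity

lemma sum_peers_con_layer_le_one {Δ : ℕ} (hΔ : Δ ≠ 0) {σ : V → ℝ} {d : ℕ} {v : V}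
    (hcard : (peers S.con v).card ≤ Δ) (h : S.lower σ d v ≤ S.upper σ d v) :
    ∑ u ∈ peers S.con v, S.w u * S.layer Δ σ d u ≤ 1 := by
  have hΔ' : (0 : ℝ) < Δ := Nat.cast_pos.2 (Nat.pos_of_ne_zero hΔ)
  set T := ∑ u ∈ peers S.con v, S.w u * S.lower σ d u
  have hupper : ∀ u ∈ peers S.con v,
      S.w u * S.upper σ d u = 1 - T + S.w u * S.lower σ d u := fun u hu => by
    rw [upper, w_mul_upperOf, peers_congr (mem_peers.1 hu)]
  have hslack : 0 ≤ 1 - T := by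
    have := mul_le_mul_of_nonneg_left h (S.w_pos v).le
    linarith [hupper v (self_mem_peers S.con v)]
  calc ∑ u ∈ peers S.con v, S.w u * S.layer Δ σ d u
      = ∑ u ∈ peers S.con v, ((1 - T) / Δ + S.w u * S.lower σ d u) :=
        Finset.sum_congr rfl fun u hu => by
          rw [layer]
          field_simp
          linear_combination hupper u hu
    _ = (peers S.con v).card * ((1 - T) / Δ) + T := by
        rw [Finset.sum_add_distrib, Finset.sum_const, nsmul_eq_mul]
    _ ≤ Δ * ((1 - T) / Δ) + T := by gcongr
    _ = 1 := by rw [mul_div_cancel₀ _ hΔ'.ne', sub_add_cancel]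

lemma sum_peers_con_averagedLayer_le_one {Δ R : ℕ} (hΔ : Δ ≠ 0) {σ : V → ℝ} {v : V}
    (hcard : (peers S.con v).card ≤ Δ) (h : S.lower σ R v ≤ S.upper σ R v) :
    ∑ u ∈ peers S.con v, S.w u * S.averagedLayer Δ R σ u ≤ 1 := by
  simp only [averagedLayer, mul_div_assoc', ← Finset.sum_div, Finset.mul_sum]
  rw [Finset.sum_comm]
  refine div_le_one_of_le₀ ?_ R.cast_nonneg
  calc ∑ d ∈ Finset.range R, ∑ u ∈ peers S.con v, S.w u * S.layer Δ σ d u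
      ≤ ∑ _d ∈ Finset.range R, (1 : ℝ) := Finset.sum_le_sum fun d hd =>
        sum_peers_con_layer_le_one hΔ hcard (lower_le_upper_of_le (Finset.mem_range.1 hd).le h)
    _ = R := by simp

/-- The target of each agent is at most its lower bound plus the upper bounds of the other agents
of the objective. -/
lemma sum_target_le_sum_bounds (σ : V → ℝ) (d : ℕ) (v : V) :
    ∑ u ∈ peers S.obj v, σ u ≤ ∑ u ∈ peers S.obj v, S.lower σ (d + 1) u +
      ((peers S.obj v).card - 1) * ∑ u ∈ peers S.obj v, S.upper σ d u := by
  have htarget : ∀ u ∈ peers S.obj v, σ u ≤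
      S.lower σ (d + 1) u + (∑ x ∈ peers S.obj v, S.upper σ d x - S.upper σ d u) := by
    intro u hu
    rw [← peers_congr (mem_peers.1 hu)]
    exact sub_le_iff_le_add.1 (le_max_right _ _)
  refine (Finset.sum_le_sum htarget).trans_eq ?_
  rw [Finset.sum_add_distrib, Finset.sum_sub_distrib, Finset.sum_const, nsmul_eq_mul]
  ring

lemma lower_succ_le_target {σ : V → ℝ} {d : ℕ} {v : V} (hσ : 0 ≤ σ v)
    (h : ∀ u ∈ peers S.obj v, 0 ≤ S.upper σ d u) : S.lower σ (d + 1) v ≤ σ v := by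
  have hothers := sum_sub_self_le_sum_sub_self (self_mem_peers S.obj v) (f := 0) h
  simp only [Pi.zero_apply, Finset.sum_const_zero, sub_zero] at hothers
  exact max_le hσ (sub_le_self _ hothers)

lemma sum_lower_le_sum_target {R : ℕ} {σ : V → ℝ} {v : V} (hσ : ∀ u ∈ peers S.obj v, 0 ≤ σ u)
    (h : ∀ u ∈ peers S.obj v, S.lower σ R u ≤ S.upper σ R u) :
    ∑ u ∈ peers S.obj v, S.lower σ R u ≤ ∑ u ∈ peers S.obj v, σ u := by
  refine Finset.sum_le_sum fun u hu => ?_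
  cases R with
  | zero => exact hσ u hu
  | succ R =>
    refine lower_succ_le_target (hσ u hu) fun x hx => (lower_nonneg (S := S) σ R x).trans ?_
    rw [peers_congr (mem_peers.1 hu)] at hx
    exact lower_le_upper_of_le R.le_succ (h x hx)

/-- The lower bounds of depth `d + 1` and the upper bounds of depth `d` together meet the targets.
Summed over `d < R`, the lower bounds telescope back to those of depth `d`, at the cost of those
of depth `R`; this costs one of the `R` copies of the targets. -/
lemma sub_one_mul_sum_target_le {R : ℕ} {σ : V → ℝ} {v : V}
    (hσ : ∀ u ∈ peers S.obj v, 0 ≤ σ u)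
    (h : ∀ u ∈ peers S.obj v, S.lower σ R u ≤ S.upper σ R u) :
    (R - 1) * ∑ u ∈ peers S.obj v, σ u ≤
      ∑ d ∈ Finset.range R, ∑ u ∈ peers S.obj v, S.lower σ d u +
        ((peers S.obj v).card - 1) *
          ∑ d ∈ Finset.range R, ∑ u ∈ peers S.obj v, S.upper σ d u := by
  have htelescope : ∑ d ∈ Finset.range R, ∑ u ∈ peers S.obj v, S.lower σ (d + 1) u =
      ∑ d ∈ Finset.range R, ∑ u ∈ peers S.obj v, S.lower σ d u +
        ∑ u ∈ peers S.obj v, S.lower σ R u := by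
    rw [← Finset.sum_range_succ, Finset.sum_range_succ']
    simp [lower]
  have hsum := Finset.sum_le_sum fun d (_ : d ∈ Finset.range R) =>
    sum_target_le_sum_bounds (S := S) σ d v
  rw [Finset.sum_const, Finset.card_range, nsmul_eq_mul, Finset.sum_add_distrib,
    ← Finset.mul_sum, htelescope] at hsum
  linarith [sum_lower_le_sum_target hσ h]

lemma sum_averagedLayer (s : Finset V) (Δ R : ℕ) (σ : V → ℝ) :
    ∑ u ∈ s, S.averagedLayer Δ R σ u =
      (∑ d ∈ Finset.range R, ∑ u ∈ s, S.upper σ d u +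
        (Δ - 1) * ∑ d ∈ Finset.range R, ∑ u ∈ s, S.lower σ d u) / (Δ * R) := by
  simp only [averagedLayer, layer]
  rw [← Finset.sum_div, Finset.sum_comm]
  simp only [← Finset.sum_div, Finset.sum_add_distrib, ← Finset.mul_sum]
  rw [div_div]

end AgentSystem

lemma mul_le_add_sub_one_mul {𝕜 : Type*} [Field 𝕜] [LinearOrder 𝕜] [IsStrictOrderedRing 𝕜]
    {n Δ ω A B : 𝕜} (hn : 0 < n) (hnΔ : n ≤ Δ) (hAB : A ≤ B)
    (h : n * ω ≤ A + (n - 1) * B) : Δ * ω ≤ A + (Δ - 1) * B := by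
  have hω : ω ≤ B - (B - A) / n := by
    rw [le_sub_iff_add_le, ← le_sub_iff_add_le', div_le_iff₀ hn]
    linarith
  have hdiv : B - A ≤ Δ * ((B - A) / n) := by
    rw [mul_div_assoc', le_div_iff₀ hn, mul_comm]
    exact mul_le_mul_of_nonneg_right hnΔ (sub_nonneg.2 hAB)
  have := mul_le_mul_of_nonneg_left hω (hn.le.trans hnΔ)
  linarith

namespace AgentSystem

variable {V I K : Type*} [Fintype V] {S : AgentSystem V I K}

lemma le_sum_peers_obj_averagedLayer {ΔI ΔK R : ℕ} (hI : 2 ≤ ΔI) (hK : 2 ≤ ΔK) (hR : R ≠ 0)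
    {σ : V → ℝ} {v : V} (hcard : (peers S.obj v).card ≤ ΔK)
    (h : ∀ u ∈ peers S.obj v, S.lower σ R u ≤ S.upper σ R u)
    {ω : ℝ} (hω : 0 ≤ ω) (hωσ : ∀ u ∈ peers S.obj v, ω ≤ σ u) :
    ω * (1 - 1 / R) ≤
      ΔI * (1 - 1 / ΔK) * ∑ u ∈ peers S.obj v, S.averagedLayer ΔI R σ u := by
  rw [sum_averagedLayer]
  set n := ((peers S.obj v).card : ℝ)
  set A := ∑ d ∈ Finset.range R, ∑ u ∈ peers S.obj v, S.lower σ d u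
  set B := ∑ d ∈ Finset.range R, ∑ u ∈ peers S.obj v, S.upper σ d u
  have hn : 0 < n := Nat.cast_pos.2 (Finset.card_pos.2 ⟨v, self_mem_peers S.obj v⟩)
  have hI' : (2 : ℝ) ≤ ΔI := Nat.ofNat_le_cast.2 hI
  have hK' : (2 : ℝ) ≤ ΔK := Nat.ofNat_le_cast.2 hK
  have hR' : (1 : ℝ) ≤ R := Nat.one_le_cast.2 (Nat.one_le_iff_ne_zero.2 hR)
  have hA : 0 ≤ A := Finset.sum_nonneg fun d _ => Finset.sum_nonneg fun u _ => lower_nonneg σ d u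
  have hAB : A ≤ B := Finset.sum_le_sum fun d hd => Finset.sum_le_sum fun u hu =>
    lower_le_upper_of_le (Finset.mem_range.1 hd).le (h u hu)
  have htarget : n * (ω * (R - 1)) ≤ A + (n - 1) * B :=
    calc n * (ω * (R - 1)) = (R - 1) * ∑ _u ∈ peers S.obj v, ω := by
          rw [Finset.sum_const, nsmul_eq_mul]
          ring
      _ ≤ (R - 1) * ∑ u ∈ peers S.obj v, σ u :=
          mul_le_mul_of_nonneg_left (Finset.sum_le_sum hωσ) (sub_nonneg.2 hR')
      _ ≤ A + (n - 1) * B := sub_one_mul_sum_target_le (fun u hu => hω.trans (hωσ u hu)) h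
  have hdegree : ΔK * (ω * (R - 1)) ≤ A + (ΔK - 1) * B :=
    mul_le_add_sub_one_mul hn (Nat.cast_le.2 hcard) hAB htarget
  have hlower : A ≤ (ΔK - 1) * (ΔI - 1) * A :=
    le_mul_of_one_le_left hA (one_le_mul_of_one_le_of_one_le (by linarith) (by linarith))
  calc ω * (1 - 1 / R) = ΔK * (ω * (R - 1)) / (ΔK * R) := by field_simp
    _ ≤ (ΔK - 1) * (B + (ΔI - 1) * A) / (ΔK * R) :=
        div_le_div_of_nonneg_right (by linarith) (by positivity)
    _ = ΔI * (1 - 1 / ΔK) * ((B + (ΔI - 1) * A) / (ΔI * R)) := by field_simp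

end AgentSystem

universe u₁ u₂ u₃

/-- A bipartite max-min linear program with a port numbering: the input of a local algorithm. -/
structure PortedLP (V I K : Type*) where
  lp : MaxMinLP V I K
  bipartite : lp.IsBipartite
  numbering : lp.PortNumbering

namespace PortedLP

variable {V I K : Type*} (X : PortedLP V I K)

/-- The constraint of the agent `v`. -/
noncomputable def con (v : V) : I :=
  (X.bipartite v).1.choose

/-- The objective of the agent `v`. -/
noncomputable def obj (v : V) : K :=
  (X.bipartite v).2.choose

/-- The coefficient of the agent `v` in its constraint. -/
noncomputable def conCoeff (v : V) : ℝ :=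
  X.lp.a (X.con v) v

/-- The coefficient of the agent `v` in its objective. -/
noncomputable def objCoeff (v : V) : ℝ :=
  X.lp.c (X.obj v) v

/-- An agent is active if both of its coefficients are positive. The algorithm assigns the value
`0` to the other agents. -/
abbrev IsActive (v : V) : Prop :=
  0 < X.conCoeff v ∧ 0 < X.objCoeff v

/-- The type of active agents. -/
abbrev Active : Type _ :=
  {v : V // X.IsActive v}

/-- The system of the active agents, in which the variable of the agent `v` is its contribution
`X.objCoeff v * x v` to its objective. -/
noncomputable def system : AgentSystem X.Active I K where
  con v := X.con v
  obj v := X.obj v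
  w v := X.conCoeff v / X.objCoeff v
  w_pos v := div_pos v.2.1 v.2.2

variable {X}

lemma adj_constr_iff {v : V} {i : I} :
    X.lp.graph.Adj (.agent v) (.constr i) ↔ X.con v = i :=
  ⟨fun h => ((X.bipartite v).1.choose_spec.2 i h).symm,
    fun h => h ▸ (X.bipartite v).1.choose_spec.1⟩

lemma adj_obj_iff {v : V} {k : K} :
    X.lp.graph.Adj (.agent v) (.obj k) ↔ X.obj v = k :=
  ⟨fun h => ((X.bipartite v).2.choose_spec.2 k h).symm,
    fun h => h ▸ (X.bipartite v).2.choose_spec.1⟩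

lemma conCoeff_nonneg (v : V) : 0 ≤ X.conCoeff v :=
  X.lp.a_nonneg _ v (adj_constr_iff.2 rfl)

lemma objCoeff_nonneg (v : V) : 0 ≤ X.objCoeff v :=
  X.lp.c_nonneg _ v (adj_obj_iff.2 rfl)

lemma objCoeff_eq_zero_of_not_isActive (hX : X.lp.NonDegenerate) {v : V} (hv : ¬ X.IsActive v) :
    X.objCoeff v = 0 := by
  by_contra hne
  have hpos : 0 < X.objCoeff v := (objCoeff_nonneg v).lt_of_ne' hne
  exact hv ⟨hX v _ _ (adj_constr_iff.2 rfl) (adj_obj_iff.2 rfl) hpos, hpos⟩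

end PortedLP

/-- The unfolding of a node of a numbered graph to a finite depth: what the node can learn in as
many rounds. The children are listed in the order of the ports. -/
structure View where
  input : LocalInput
  children : List View

namespace View

/-- The view of radius `n` contained in a view of larger radius. -/
def trunc : ℕ → View → View
  | 0, t => ⟨t.input, []⟩
  | n + 1, t => ⟨t.input, t.children.map (trunc n)⟩

/-- The coefficients that the root of the view knows, if it is an agent. -/
def edges (t : View) : List (ℝ ⊕ ℝ) :=
  match t.input with
  | .agent e => e
  | _ => []

/-- The coefficient of the root in its constraint. If the root is not an agent, this is
`sSup ∅ = 0`, so that the root does not count as active. -/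
noncomputable def conCoeff (t : View) : ℝ :=
  sSup {x | .inl x ∈ t.edges}

/-- The coefficient of the root in its objective, or `0` if the root is not an agent. -/
noncomputable def objCoeff (t : View) : ℝ :=
  sSup {x | .inr x ∈ t.edges}

/-- The root of the view is an active agent. -/
abbrev IsActive (t : View) : Prop :=
  0 < t.conCoeff ∧ 0 < t.objCoeff

/-- The value of `F` at a view whose root is an active agent. -/
noncomputable def activeValue? {α : Type*} (F : View → α) (t : View) : Option α :=
  if t.IsActive then some (F t) else none

/-- The root of the view is a constraint. -/
def isConstr (t : View) : Bool :=
  match t.input with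
  | .constr _ => true
  | _ => false

/-- The root of the view is an objective. -/
def isObj (t : View) : Bool :=
  match t.input with
  | .obj _ => true
  | _ => false

/-- The values of `F` at the active agents two steps away from the root, through the first
neighbour that satisfies `p`. -/
noncomputable def valuesVia {α : Type*} (p : View → Bool) (F : View → α) (t : View) :
    Multiset α :=
  (t.children.find? p).elim 0 fun c => c.children.filterMap (activeValue? F)

end View

namespace PortedLP

section View

variable {V I K : Type*} (X : PortedLP V I K)

/-- The view of the node `s` of radius `r`. -/
def view : ℕ → Node V I K → View
  | 0, s => ⟨PortAlgorithm.localInput X.numbering s, []⟩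
  | r + 1, s => ⟨PortAlgorithm.localInput X.numbering s, (X.numbering.ports s).map (view r)⟩

/-- The active agent at a node. -/
noncomputable def toActive? : Node V I K → Option X.Active
  | .agent v => if h : X.IsActive v then some ⟨v, h⟩ else none
  | _ => none

variable {X} {r : ℕ}

@[simp]
lemma input_view (r : ℕ) (s : Node V I K) :
    (X.view r s).input = PortAlgorithm.localInput X.numbering s := by
  cases r <;> rfl

lemma trunc_view {m n : ℕ} (h : m ≤ n) (s : Node V I K) : (X.view n s).trunc m = X.view m s := by
  induction m generalizing n s with
  | zero => simp only [View.trunc, input_view, view]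
  | succ m ih =>
    obtain ⟨n, rfl⟩ := Nat.exists_eq_add_of_lt h
    simp only [View.trunc, view, List.map_map]
    congr 1
    exact List.map_congr_left fun t _ => ih (by lia) t

lemma inl_mem_edges_view {v : V} {x : ℝ} :
    .inl x ∈ (X.view r (.agent v)).edges ↔ x = X.conCoeff v := by
  simp only [View.edges, input_view, PortAlgorithm.localInput, List.mem_filterMap,
    X.numbering.mem_ports]
  constructor
  · rintro ⟨_ | i | k, hadj, h⟩
    · cases h
    · cases h
      rw [conCoeff, adj_constr_iff.1 hadj]
    · cases h
  · rintro rfl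
    exact ⟨.constr (X.con v), adj_constr_iff.2 rfl, rfl⟩

lemma inr_mem_edges_view {v : V} {x : ℝ} :
    .inr x ∈ (X.view r (.agent v)).edges ↔ x = X.objCoeff v := by
  simp only [View.edges, input_view, PortAlgorithm.localInput, List.mem_filterMap,
    X.numbering.mem_ports]
  constructor
  · rintro ⟨_ | i | k, hadj, h⟩
    · cases h
    · cases h
    · cases h
      rw [objCoeff, adj_obj_iff.1 hadj]
  · rintro rfl
    exact ⟨.obj (X.obj v), adj_obj_iff.2 rfl, rfl⟩

lemma conCoeff_view (v : V) : (X.view r (.agent v)).conCoeff = X.conCoeff v := by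
  simp [View.conCoeff, inl_mem_edges_view]

lemma objCoeff_view (v : V) : (X.view r (.agent v)).objCoeff = X.objCoeff v := by
  simp [View.objCoeff, inr_mem_edges_view]

lemma activeValue?_view {α : Type*} {f : X.Active → α} {F : View → α}
    (hF : ∀ v : X.Active, f v = F (X.view r (.agent v))) (s : Node V I K) :
    (X.view r s).activeValue? F = (X.toActive? s).map f := by
  cases s with
  | agent v =>
    simp only [View.activeValue?, View.IsActive, conCoeff_view, objCoeff_view, toActive?]
    split_ifs with h
    · rw [Option.map_some, hF]
    · rfl
  | constr i => simp [View.activeValue?, View.IsActive, View.conCoeff, View.edges, toActive?,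
      PortAlgorithm.localInput]
  | obj k => simp [View.activeValue?, View.IsActive, View.conCoeff, View.edges, toActive?,
      PortAlgorithm.localInput]

lemma toActive?_eq_some {s : Node V I K} {v : X.Active} :
    X.toActive? s = some v ↔ s = .agent v := by
  cases s with
  | agent u =>
    simp only [toActive?, Node.agent.injEq]
    split_ifs with h
    · rw [Option.some_inj, Subtype.ext_iff]
    · simp only [false_iff]
      exact fun hu => h (hu ▸ v.2)
  | constr i => simp [toActive?]
  | obj k => simp [toActive?]

lemma peers_val [Fintype V] {ι : Type*} {label : X.Active → ι} {v : X.Active} {s : Node V I K}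
    (hs : ∀ u : X.Active, label u = label v ↔ X.lp.graph.Adj (.agent u) s) :
    (peers label v).val = ((X.numbering.ports s).filterMap X.toActive? : Multiset X.Active) := by
  have hnodup : ((X.numbering.ports s).filterMap X.toActive?).Nodup :=
    (X.numbering.nodup s).filterMap fun t t' u ht ht' =>
      (toActive?_eq_some.1 ht).trans (toActive?_eq_some.1 ht').symm
  refine (Multiset.Nodup.ext (peers label v).nodup (Multiset.coe_nodup.2 hnodup)).2 fun u => ?_
  rw [Finset.mem_val, mem_peers, hs, Multiset.mem_coe, List.mem_filterMap]
  simp only [toActive?_eq_some, exists_eq_right, X.numbering.mem_ports, X.lp.graph.adj_comm]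

lemma find?_children_view {p : View → Bool} {s t : Node V I K} (ht : X.lp.graph.Adj s t)
    (hp : ∀ t', X.lp.graph.Adj s t' → (p (X.view r t') ↔ t' = t)) :
    (X.view (r + 1) s).children.find? p = some (X.view r t) := by
  have hmem : t ∈ X.numbering.ports s := (X.numbering.mem_ports s t).2 ht
  obtain ⟨t', hfind⟩ : ∃ t', (X.numbering.ports s).find? (p ∘ X.view r) = some t' :=
    Option.isSome_iff_exists.1 (List.find?_isSome.2 ⟨t, hmem, (hp t ht).2 rfl⟩)
  have hadj : X.lp.graph.Adj s t' :=
    (X.numbering.mem_ports s t').1 (List.mem_of_find?_eq_some hfind)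
  obtain rfl := (hp t' hadj).1 (List.find?_some (p := p ∘ X.view r) hfind)
  rw [view, List.find?_map, hfind, Option.map_some]

lemma map_peers_val_eq_valuesVia [Fintype V] {ι α : Type*} {label : X.Active → ι} {v : X.Active}
    {s : Node V I K} (hs : ∀ u : X.Active, label u = label v ↔ X.lp.graph.Adj (.agent u) s)
    {p : View → Bool}
    (hp : ∀ t, X.lp.graph.Adj (.agent v) t → (p (X.view (r + 1) t) ↔ t = s))
    {f : X.Active → α} {F : View → α} (hF : ∀ u : X.Active, f u = F (X.view r (.agent u))) :
    (peers label v).val.map f = (X.view (r + 2) (.agent v)).valuesVia p F := by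
  rw [View.valuesVia, find?_children_view ((hs v).1 rfl) hp, Option.elim_some, view,
    List.filterMap_map, peers_val hs, Multiset.map_coe, List.map_filterMap]
  congr 1
  exact List.filterMap_congr fun t _ => (activeValue?_view hF t).symm

lemma isConstr_view_iff {v : V} {t : Node V I K} (ht : X.lp.graph.Adj (.agent v) t) :
    (X.view r t).isConstr ↔ t = .constr (X.con v) := by
  cases t with
  | agent u => exact absurd ht (X.lp.not_adj_agent_agent v u)
  | constr i => simp [View.isConstr, PortAlgorithm.localInput, adj_constr_iff.1 ht]
  | obj k => simp [View.isConstr, PortAlgorithm.localInput]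

lemma isObj_view_iff {v : V} {t : Node V I K} (ht : X.lp.graph.Adj (.agent v) t) :
    (X.view r t).isObj ↔ t = .obj (X.obj v) := by
  cases t with
  | agent u => exact absurd ht (X.lp.not_adj_agent_agent v u)
  | constr i => simp [View.isObj, PortAlgorithm.localInput]
  | obj k => simp [View.isObj, PortAlgorithm.localInput, adj_obj_iff.1 ht]

end View

/-- A quantity defined for each active agent of each instance is local if it is a function, the same
for all instances, of the view of the agent of some fixed radius. -/
def IsLocal {α : Type*} (f : ∀ {V : Type u₁} {I : Type u₂} {K : Type u₃} [Fintype V]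
    (X : PortedLP V I K), X.Active → α) : Prop :=
  ∃ (r : ℕ) (F : View → α), ∀ {V : Type u₁} {I : Type u₂} {K : Type u₃} [Fintype V]
    (X : PortedLP V I K) (v : X.Active), f X v = F (X.view r (.agent v))

section IsLocal

variable {α β γ Ω : Type*}
  {f : ∀ {V : Type u₁} {I : Type u₂} {K : Type u₃} [Fintype V] (X : PortedLP V I K),
    X.Active → α}
  {g : ∀ {V : Type u₁} {I : Type u₂} {K : Type u₃} [Fintype V] (X : PortedLP V I K),
    X.Active → β}
  {σ U : ∀ {V : Type u₁} {I : Type u₂} {K : Type u₃} [Fintype V] (X : PortedLP V I K),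
    Ω → X.Active → ℝ}

lemma isLocal_const (x : α) : IsLocal.{u₁, u₂, u₃} fun _ _ => x :=
  ⟨0, fun _ => x, fun _ _ => rfl⟩

lemma IsLocal.comp (hf : IsLocal f) (φ : α → β) : IsLocal fun X v => φ (f X v) := by
  obtain ⟨r, F, hF⟩ := hf
  exact ⟨r, fun t => φ (F t), fun X v => congrArg φ (hF X v)⟩

lemma IsLocal.comp₂ (hf : IsLocal f) (hg : IsLocal g) (φ : α → β → γ) :
    IsLocal fun X v => φ (f X v) (g X v) := by
  obtain ⟨m, F, hF⟩ := hf
  obtain ⟨n, G, hG⟩ := hg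
  refine ⟨max m n, fun t => φ (F (t.trunc m)) (G (t.trunc n)), fun X v => ?_⟩
  simp only [trunc_view (le_max_left m n), trunc_view (le_max_right m n), hF, hG]

lemma isLocal_w : IsLocal.{u₁, u₂, u₃} fun X v => X.system.w v :=
  ⟨0, fun t => t.conCoeff / t.objCoeff, fun X v => by
    simp only [conCoeff_view, objCoeff_view, system]⟩

lemma IsLocal.map_con_peers (hf : IsLocal f) :
    IsLocal fun X v => (peers X.system.con v).val.map (f X) := by
  obtain ⟨r, F, hF⟩ := hf
  exact ⟨r + 2, View.valuesVia View.isConstr F, fun X v =>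
    map_peers_val_eq_valuesVia (fun _ => adj_constr_iff.symm) (fun _ => isConstr_view_iff) (hF X)⟩

lemma IsLocal.map_obj_peers (hf : IsLocal f) :
    IsLocal fun X v => (peers X.system.obj v).val.map (f X) := by
  obtain ⟨r, F, hF⟩ := hf
  exact ⟨r + 2, View.valuesVia View.isObj F, fun X v =>
    map_peers_val_eq_valuesVia (fun _ => adj_obj_iff.symm) (fun _ => isObj_view_iff) (hF X)⟩

/-- The bounds are treated as functions of a parameter in `Ω`, since `maxTarget` depends on the
bounds for all uniform targets at once. -/
lemma IsLocal.upperOf (hU : IsLocal fun X v ω => U X ω v) :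
    IsLocal fun X v ω => X.system.upperOf (U X ω) v := by
  have hterm := isLocal_w.comp₂ hU fun w L ω => w * L ω
  have hsum := hterm.map_con_peers.comp fun m ω => (m.map fun g => g ω).sum
  have hdiff := hsum.comp₂ hterm fun T x ω => 1 - (T ω - x ω)
  convert hdiff.comp₂ isLocal_w fun x w ω => x ω / w using 5
  simp only [Multiset.map_map]
  rfl

lemma IsLocal.lowerOf (hσ : IsLocal fun X v ω => σ X ω v) (hU : IsLocal fun X v ω => U X ω v) :
    IsLocal fun X v ω => X.system.lowerOf (σ X ω) (U X ω) v := by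
  have hsum := hU.map_obj_peers.comp fun m ω => (m.map fun g => g ω).sum
  have hothers := hsum.comp₂ hU fun T x ω => T ω - x ω
  convert hσ.comp₂ hothers fun s T ω => max 0 (s ω - T ω) using 5
  simp only [Multiset.map_map]
  rfl

lemma IsLocal.lower (hσ : IsLocal fun X v ω => σ X ω v) (d : ℕ) :
    IsLocal fun X v ω => X.system.lower (σ X ω) d v := by
  induction d with
  | zero => exact isLocal_const fun _ => 0
  | succ d ih => exact hσ.lowerOf ih.upperOf

lemma IsLocal.upper (hσ : IsLocal fun X v ω => σ X ω v) (d : ℕ) :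
    IsLocal fun X v ω => X.system.upper (σ X ω) d v :=
  (hσ.lower d).upperOf

lemma isLocal_maxTarget (R : ℕ) : IsLocal.{u₁, u₂, u₃} fun X v => X.system.maxTarget R v := by
  have huniform : IsLocal.{u₁, u₂, u₃} fun _ _ (ω : ℝ) => ω := isLocal_const fun ω => ω
  exact (huniform.lower R).comp₂ (huniform.upper R) fun L U => sSup {ω | 0 ≤ ω ∧ L ω ≤ U ω}

lemma IsLocal.image_nbrs (hf : IsLocal f) :
    IsLocal fun X v => f X '' X.system.nbrs v := by
  convert hf.map_con_peers.comp₂ hf.map_obj_peers fun m m' => {x | x ∈ m ∨ x ∈ m'} using 5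
  ext x
  simp only [Set.mem_image, AgentSystem.nbrs, Set.mem_ofPred_eq, Multiset.mem_map, Finset.mem_val,
    mem_peers, ← exists_or, ← or_and_right]

lemma IsLocal.image_reach (hf : IsLocal f) (n : ℕ) :
    IsLocal fun X v => f X '' X.system.reach n v := by
  induction n with
  | zero =>
    simp only [AgentSystem.reach, Set.image_singleton]
    exact hf.comp fun x => ({x} : Set α)
  | succ n ih =>
    simp only [AgentSystem.reach, Set.image_iUnion₂]
    simp only [← Set.sUnion_image]
    exact ih.image_nbrs.comp Set.sUnion

lemma isLocal_localTarget (R : ℕ) : IsLocal.{u₁, u₂, u₃} fun X v => X.system.localTarget R v :=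
  ((isLocal_maxTarget R).image_reach (2 * R + 1)).comp sInf

lemma IsLocal.averagedLayer {τ : ∀ {V : Type u₁} {I : Type u₂} {K : Type u₃} [Fintype V]
    (X : PortedLP V I K), X.Active → ℝ} (hτ : IsLocal τ) (Δ R : ℕ) :
    IsLocal fun X v => X.system.averagedLayer Δ R (τ X) v := by
  have hconst : IsLocal fun X v (_ : Unit) => τ X v := hτ.comp fun x _ => x
  have hlayer (d : ℕ) : IsLocal fun X v => X.system.layer Δ (τ X) d v :=
    (hconst.upper d).comp₂ (hconst.lower d) fun U L => (U () + (Δ - 1) * L ()) / Δ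
  have hsum (n : ℕ) :
      IsLocal fun X v => ∑ d ∈ Finset.range n, X.system.layer Δ (τ X) d v := by
    induction n with
    | zero => exact isLocal_const 0
    | succ n ih =>
      simp only [Finset.sum_range_succ]
      exact ih.comp₂ (hlayer n) (· + ·)
  exact (hsum R).comp fun x => x / R

end IsLocal

/-- The algorithm in which every node collects its view of radius `r`, by repeatedly sending its
current view through all ports, and then applies `out`. -/
def gatherAlgorithm (r : ℕ) (out : View → ℝ) : PortAlgorithm where
  State := View
  Msg := View
  horizon := r
  init input := ⟨input, []⟩
  send t _ := t
  step t messages := ⟨t.input, messages⟩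
  output := out

lemma state_gatherAlgorithm {V I K : Type*} (X : PortedLP V I K) (r : ℕ) (out : View → ℝ) (n : ℕ)
    (s : Node V I K) : (gatherAlgorithm r out).state X.numbering n s = X.view n s := by
  induction n generalizing s with
  | zero => rfl
  | succ n ih =>
    rw [PortAlgorithm.state, ih]
    simp only [ih]
    simp only [gatherAlgorithm, input_view, view]

section Denormalize

variable {V I K : Type*} (X : PortedLP V I K)

/-- The solution of the max-min linear program in which the active agents contribute `y` to their
objectives and the other agents have the value `0`. -/
noncomputable def denormalize (y : X.Active → ℝ) (v : V) : ℝ :=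
  if h : X.IsActive v then y ⟨v, h⟩ / X.objCoeff v else 0

variable {X} {y : X.Active → ℝ}

lemma denormalize_of_not_isActive {v : V} (hv : ¬ X.IsActive v) : X.denormalize y v = 0 :=
  dif_neg hv

lemma denormalize_coe (v : X.Active) : X.denormalize y v = y v / X.objCoeff v :=
  dif_pos v.2

lemma conCoeff_mul_denormalize (v : X.Active) :
    X.conCoeff v * X.denormalize y v = X.system.w v * y v := by
  rw [denormalize_coe, mul_div_left_comm, mul_comm]
  rfl

lemma objCoeff_mul_denormalize (v : X.Active) : X.objCoeff v * X.denormalize y v = y v := by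
  rw [denormalize_coe, mul_div_cancel₀ _ v.2.2.ne']

end Denormalize

theorem IsLocal.exists_portAlgorithm {f : ∀ {V : Type u₁} {I : Type u₂} {K : Type u₃} [Fintype V]
    (X : PortedLP V I K), X.Active → ℝ} (hf : IsLocal f) :
    ∃ A : PortAlgorithm, ∀ {V : Type u₁} {I : Type u₂} {K : Type u₃} [Fintype V]
      (X : PortedLP V I K), A.run X.numbering = X.denormalize (f X) := by
  obtain ⟨r, F, hF⟩ := hf
  refine ⟨gatherAlgorithm r fun t => if t.IsActive then F t / t.objCoeff else 0, fun X => ?_⟩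
  funext v
  rw [PortAlgorithm.run, state_gatherAlgorithm]
  simp only [gatherAlgorithm, View.IsActive, conCoeff_view, objCoeff_view]
  split_ifs with hv
  · rw [← hF X ⟨v, hv⟩]
    exact (denormalize_coe ⟨v, hv⟩).symm
  · exact (denormalize_of_not_isActive hv).symm

section Solution

variable {V I K : Type*} [Fintype V] {X : PortedLP V I K}

lemma mem_constrAgents {v : V} {i : I} : v ∈ X.lp.constrAgents i ↔ X.con v = i := by
  simp [MaxMinLP.constrAgents, adj_constr_iff]

lemma mem_objAgents {v : V} {k : K} : v ∈ X.lp.objAgents k ↔ X.obj v = k := by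
  simp [MaxMinLP.objAgents, adj_obj_iff]

lemma sum_constrAgents (i : I) (x : V → ℝ) :
    ∑ v ∈ X.lp.constrAgents i, X.lp.a i v * x v =
      ∑ v ∈ X.lp.constrAgents i, X.conCoeff v * x v :=
  Finset.sum_congr rfl fun v hv => by rw [conCoeff, mem_constrAgents.1 hv]

lemma objective_eq_sum_objCoeff (k : K) (x : V → ℝ) :
    X.lp.objective k x = ∑ v ∈ X.lp.objAgents k, X.objCoeff v * x v :=
  Finset.sum_congr rfl fun v hv => by rw [objCoeff, mem_objAgents.1 hv]

section Peers

variable {ι : Type*} {label : X.Active → ι} {v : X.Active} {s : Finset V}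

lemma map_peers (hs : ∀ u : X.Active, label u = label v ↔ ↑u ∈ s) :
    (peers label v).map (Function.Embedding.subtype _) = {u ∈ s | X.IsActive u} := by
  ext u
  simp [mem_peers, hs, and_comm]

lemma card_peers_le (hs : ∀ u : X.Active, label u = label v ↔ ↑u ∈ s) :
    (peers label v).card ≤ s.card := by
  rw [← Finset.card_map (Function.Embedding.subtype _), map_peers hs]
  exact Finset.card_filter_le _ _

lemma sum_peers_eq_sum_filter (hs : ∀ u : X.Active, label u = label v ↔ ↑u ∈ s) (g : V → ℝ) :
    ∑ u ∈ peers label v, g u = ∑ u ∈ s with X.IsActive u, g u := by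
  rw [← map_peers hs, Finset.sum_map]
  rfl

lemma sum_peers_eq_sum (hs : ∀ u : X.Active, label u = label v ↔ ↑u ∈ s) {g : V → ℝ}
    (hg : ∀ u, ¬ X.IsActive u → g u = 0) : ∑ u ∈ peers label v, g u = ∑ u ∈ s, g u := by
  rw [sum_peers_eq_sum_filter hs, Finset.sum_filter_of_ne]
  exact fun u _ hu => not_imp_comm.1 (hg u) hu

end Peers

lemma sum_constrAgents_denormalize (v : X.Active) (y : X.Active → ℝ) :
    ∑ u ∈ X.lp.constrAgents (X.con v), X.lp.a (X.con v) u * X.denormalize y u =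
      ∑ u ∈ peers X.system.con v, X.system.w u * y u := by
  rw [sum_constrAgents, ← sum_peers_eq_sum (fun _ => mem_constrAgents.symm)]
  · exact Finset.sum_congr rfl fun u _ => conCoeff_mul_denormalize u
  · exact fun u hu => by rw [denormalize_of_not_isActive hu, mul_zero]

lemma objective_denormalize (v : X.Active) (y : X.Active → ℝ) :
    X.lp.objective (X.obj v) (X.denormalize y) = ∑ u ∈ peers X.system.obj v, y u := by
  rw [objective_eq_sum_objCoeff, ← sum_peers_eq_sum (fun _ => mem_objAgents.symm)]
  · exact Finset.sum_congr rfl fun u _ => objCoeff_mul_denormalize u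
  · exact fun u hu => by rw [denormalize_of_not_isActive hu, mul_zero]

lemma isFeasible_denormalize {y : X.Active → ℝ} (hy : ∀ v, 0 ≤ y v)
    (hcon : ∀ v, ∑ u ∈ peers X.system.con v, X.system.w u * y u ≤ 1) :
    X.lp.IsFeasible (X.denormalize y) := by
  refine ⟨fun i => ?_, fun v => ?_⟩
  · by_cases hi : ∃ v : X.Active, X.con v = i
    · obtain ⟨v, rfl⟩ := hi
      exact (sum_constrAgents_denormalize v y).trans_le (hcon v)
    · refine (Finset.sum_eq_zero fun u hu => ?_).trans_le zero_le_one
      rw [denormalize_of_not_isActive fun h => hi ⟨⟨u, h⟩, mem_constrAgents.1 hu⟩, mul_zero]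
  · by_cases hv : X.IsActive v
    · rw [denormalize_coe ⟨v, hv⟩]
      exact div_nonneg (hy _) (objCoeff_nonneg v)
    · rw [denormalize_of_not_isActive hv]

lemma objective_nonneg {x : V → ℝ} (hx : X.lp.IsFeasible x) (k : K) : 0 ≤ X.lp.objective k x := by
  rw [objective_eq_sum_objCoeff]
  exact Finset.sum_nonneg fun v _ => mul_nonneg (objCoeff_nonneg v) (hx.2 v)

lemma utility_nonneg {x : V → ℝ} (hx : X.lp.IsFeasible x) : 0 ≤ X.lp.utility x :=
  Real.iInf_nonneg (objective_nonneg hx)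

lemma utility_le_objective {x : V → ℝ} (hx : X.lp.IsFeasible x) (k : K) :
    X.lp.utility x ≤ X.lp.objective k x :=
  ciInf_le ⟨0, Set.forall_mem_range.2 (objective_nonneg hx)⟩ k

lemma opt_nonneg : 0 ≤ X.lp.opt :=
  Real.sSup_nonneg (Set.forall_mem_image.2 fun _ hx => utility_nonneg hx)

lemma opt_le {ω : ℝ} (hω : 0 ≤ ω) (h : ∀ x, X.lp.IsFeasible x → X.lp.utility x ≤ ω) :
    X.lp.opt ≤ ω :=
  Real.sSup_le (Set.forall_mem_image.2 h) hω

lemma meets_utility (hX : X.lp.NonDegenerate) {x : V → ℝ} (hx : X.lp.IsFeasible x) :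
    X.system.Meets (fun _ => X.lp.utility x) fun v => X.objCoeff v * x v where
  nonneg v := mul_nonneg (objCoeff_nonneg _) (hx.2 v)
  con_le v :=
    calc ∑ u ∈ peers X.system.con v, X.system.w u * (X.objCoeff u * x u)
        = ∑ u ∈ peers X.system.con v, X.conCoeff u * x u :=
          Finset.sum_congr rfl fun u _ => by
            rw [← mul_assoc, system, div_mul_cancel₀ _ u.2.2.ne']
      _ = ∑ u ∈ X.lp.constrAgents (X.con v) with X.IsActive u, X.conCoeff u * x u :=
          sum_peers_eq_sum_filter (fun _ => mem_constrAgents.symm) fun u => X.conCoeff u * x u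
      _ ≤ ∑ u ∈ X.lp.constrAgents (X.con v), X.conCoeff u * x u :=
          Finset.sum_le_sum_of_subset_of_nonneg (Finset.filter_subset _ _) fun u _ _ =>
            mul_nonneg (conCoeff_nonneg u) (hx.2 u)
      _ ≤ 1 := (sum_constrAgents _ x).symm.trans_le (hx.1 _)
  le_obj v := by
    refine (utility_le_objective hx (X.obj v)).trans_eq ?_
    rw [objective_eq_sum_objCoeff]
    exact (sum_peers_eq_sum (fun _ => mem_objAgents.symm) fun u hu => by
      rw [objCoeff_eq_zero_of_not_isActive hX hu, zero_mul]).symm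

lemma opt_le_maxTarget (hX : X.lp.NonDegenerate) {R : ℕ} (hR : R ≠ 0) (v : X.Active) :
    X.lp.opt ≤ X.system.maxTarget R v :=
  opt_le (AgentSystem.maxTarget_mem_targets hR v).1 fun _ hx =>
    (meets_utility hX hx).le_maxTarget hR (utility_nonneg hx) v

lemma opt_nonpos_of_forall_not_isActive (hX : X.lp.NonDegenerate) {k : K}
    (hk : ∀ v, X.obj v = k → ¬ X.IsActive v) : X.lp.opt ≤ 0 := by
  refine opt_le le_rfl fun x hx => (utility_le_objective hx k).trans_eq ?_
  rw [objective_eq_sum_objCoeff]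
  refine Finset.sum_eq_zero fun v hv => ?_
  rw [objCoeff_eq_zero_of_not_isActive hX (hk v (mem_objAgents.1 hv)), zero_mul]

variable (X) in
/-- The solution in which every active agent contributes to its objective the averaged layer for the
local targets. -/
noncomputable def solution (Δ R : ℕ) : V → ℝ :=
  X.denormalize (X.system.averagedLayer Δ R (X.system.localTarget R))

theorem isFeasible_solution {Δ R : ℕ} (hΔ : Δ ≠ 0) (hR : R ≠ 0)
    (hcard : ∀ i, (X.lp.constrAgents i).card ≤ Δ) : X.lp.IsFeasible (X.solution Δ R) :=
  isFeasible_denormalize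
    (fun v => AgentSystem.averagedLayer_nonneg hΔ (AgentSystem.lower_localTarget_le_upper hR v))
    fun v => AgentSystem.sum_peers_con_averagedLayer_le_one hΔ
      ((card_peers_le fun _ => mem_constrAgents.symm).trans (hcard (X.con v)))
      (AgentSystem.lower_localTarget_le_upper hR v)

theorem opt_mul_le_objective_solution (hX : X.lp.NonDegenerate) {ΔI ΔK R : ℕ} (hI : 2 ≤ ΔI)
    (hK : 2 ≤ ΔK) (hR : R ≠ 0) (hdeg : X.lp.DegreeBounded ΔI ΔK) (k : K) :
    X.lp.opt * (1 - 1 / R) ≤ ΔI * (1 - 1 / ΔK) * X.lp.objective k (X.solution ΔI R) := by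
  by_cases hk : ∃ v : X.Active, X.obj v = k
  · obtain ⟨v, rfl⟩ := hk
    rw [solution, objective_denormalize]
    exact AgentSystem.le_sum_peers_obj_averagedLayer hI hK hR
      ((card_peers_le fun _ => mem_objAgents.symm).trans (hdeg.2 (X.obj v)))
      (fun u _ => AgentSystem.lower_localTarget_le_upper hR u) opt_nonneg
      fun u _ => AgentSystem.le_localTarget (opt_le_maxTarget hX hR) u
  · have hopt : X.lp.opt = 0 := le_antisymm
      (opt_nonpos_of_forall_not_isActive hX fun v hv h => hk ⟨⟨v, h⟩, hv⟩) opt_nonneg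
    have hobj := objective_nonneg (isFeasible_solution (by lia) hR hdeg.1) k
    rw [hopt, zero_mul]
    have hK' : 0 ≤ 1 - 1 / (ΔK : ℝ) := Nat.one_sub_one_div_cast_nonneg ΔK
    positivity

end Solution

end PortedLP

lemma exists_nat_div_add_le_one_sub_one_div {𝕜 : Type*} [Field 𝕜] [LinearOrder 𝕜]
    [IsStrictOrderedRing 𝕜] [Archimedean 𝕜] {ρ ε : 𝕜} (hρ : 0 < ρ) (hε : 0 < ε) :
    ∃ R : ℕ, R ≠ 0 ∧ ρ / (ρ + ε) ≤ 1 - 1 / R := by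
  obtain ⟨n, hn⟩ := exists_nat_one_div_lt (div_pos hε (add_pos hρ hε))
  refine ⟨n + 1, n.succ_ne_zero, ?_⟩
  rw [Nat.cast_succ, le_sub_comm]
  refine hn.le.trans_eq ?_
  field_simp
  ring

theorem theorem1_general (ΔI ΔK : ℕ) (hI : 2 ≤ ΔI) (hK : 2 ≤ ΔK) (ε : ℝ) (hε : 0 < ε) :
    ∃ A : PortAlgorithm,
      ∀ (V I K : Type*) [Fintype V] (P : MaxMinLP V I K),
        P.IsBipartite → P.DegreeBounded ΔI ΔK → ∀ N : P.PortNumbering,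
          P.IsFeasible (A.run N) ∧
          (P.NonDegenerate → ∀ k : K,
            P.opt / ((ΔI : ℝ) * (1 - 1 / (ΔK : ℝ)) + ε) ≤ P.objective k (A.run N)) := by
  set ρ : ℝ := ΔI * (1 - 1 / ΔK)
  have hρ : 0 < ρ := by
    have hK' : 1 / (ΔK : ℝ) < 1 := (div_lt_one (by positivity)).2 (Nat.one_lt_cast.2 hK)
    exact mul_pos (by positivity) (sub_pos.2 hK')
  obtain ⟨R, hR, hRε⟩ := exists_nat_div_add_le_one_sub_one_div hρ hε
  obtain ⟨A, hA⟩ := ((PortedLP.isLocal_localTarget R).averagedLayer ΔI R).exists_portAlgorithm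
  refine ⟨A, fun V I K _ P hP hdeg N => ?_⟩
  let X : PortedLP V I K := ⟨P, hP, N⟩
  have hrun : A.run N = X.solution ΔI R := hA X
  rw [hrun]
  refine ⟨X.isFeasible_solution (by lia) hR hdeg.1, fun hND k => ?_⟩
  refine le_of_mul_le_mul_left ?_ hρ
  calc ρ * (P.opt / (ρ + ε)) = P.opt * (ρ / (ρ + ε)) := by ring
    _ ≤ P.opt * (1 - 1 / R) := mul_le_mul_of_nonneg_left hRε X.opt_nonneg
    _ ≤ ρ * P.objective k (X.solution ΔI R) :=
      X.opt_mul_le_objective_solution hND hI hK hR hdeg k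

theorem theorem1 (ΔI ΔK : ℕ) (hI : 2 ≤ ΔI) (hK : 2 ≤ ΔK) (ε : ℝ) (hε : 0 < ε) :
    ∃ A : PortAlgorithm,
      ∀ (V I K : Type*) [Fintype V] [Fintype I] [Fintype K] (P : MaxMinLP V I K),
        P.IsBipartite → P.DegreeBounded ΔI ΔK → ∀ N : P.PortNumbering,
          P.IsFeasible (A.run N) ∧
          (P.NonDegenerate → ∀ k : K,
            P.opt / ((ΔI : ℝ) * (1 - 1 / (ΔK : ℝ)) + ε) ≤ P.objective k (A.run N)) := by
  obtain ⟨A, hA⟩ := theorem1_general ΔI ΔK hI hK ε hε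
  exact ⟨A, fun V I K _ _ _ => hA V I K⟩
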